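/- Let $V=\mathbb{C}[x_1,x_2,\dots]$ with vacuum vector $1$. Let $\alpha(z)=\sum_{n\in\mathbb{Z}}\alpha_n z^{-n-1}$, where $\alpha_n=n\,\partial/\partial x_n$ for $n>0$, $\alpha_0=0$, and $\alpha_n$ is multiplication by $x_{-n}$ for $n<0$. The free bosonic vertex algebra is $V$ with the state-field correspondence $a\mapsto Y(a,z)=\sum_{n\in\mathbb{Z}}a_{(n)}z^{-n-1}$ that is linear in $a$ and satisfies $$Y(x_{i_1}\cdots x_{i_k},z)=\;:\partial^{(i_1-1)}\alpha(z)\cdots\partial^{(i_k-1)}\alpha(z):,\qquad \partial^{(j)}=\tfrac{1}{j!}\partial_z^{\,j},$$ where $:\ :$ is the nested normally ordered product determined by $:A(z)B(z):\;=A(z)_-B(z)+B(z)A(z)_+$ with $A(z)_-=\sum_{n<0}A_{(n)}z^{-n-1}$ and $A(z)_+=\sum_{n\ge 0}A_{(n)}z^{-n-1}$, and the empty product ($k=0$) is the identity field. Its translation operator is $Ta=a_{(-2)}1$. A non-zero vector $v\in V$ is a Virasoro vector if for some $c\in\mathbb{C}$ $$v_{(n)}v=0\ (n\ge 4),\qquad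 v_{(3)}v=\tfrac{c}{2}\,1,\qquad v_{(2)}v=0,\qquad v_{(1)}v=2v,\qquad v_{(0)}v=Tv.$$ A Virasoro vector $v$ is a conformal vector if moreover $L_{-1}=v_{(0)}$ equals $T$ and $L_0=v_{(1)}$ is semisimple. Then every Virasoro vector of the free bosonic vertex algebra is a conformal vector. The conformal vectors are exactly the vectors $$\tfrac12\mu^2+\mu x_1+\tfrac12x_1^2+\lambda x_2,\qquad \lambda,\mu\in\mathbb{C}.$$ -/

import Mathlib

open scoped VertexOperator

noncomputable section

/-! ### Fields: divided derivatives and normally ordered products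

A field on `V` is a `VertexOperator ℂ V`; the notation `A[[n]]` is its `n`-th Fourier mode, so that
`A(z) = ∑ n, A[[n]] z ^ (-n - 1)`. -/

namespace BosonField

variable {V : Type*} [AddCommGroup V] [Module ℂ V]

/-- A field has only finitely many terms of negative degree on each vector. -/
theorem exists_mode_eq_zero (A : VertexOperator ℂ V) (u : V) :
    ∃ N : ℤ, ∀ n : ℤ, N ≤ n → (A[[n]]) u = 0 := by
  refine ⟨-((HahnModule.of ℂ).symm (A u)).order, fun n hn => ?_⟩
  exact VertexOperator.ncoeff_eq_zero_of_lt_order A n u (by lia)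

/-- The field with prescribed Fourier modes. -/
def ofModes (f : ℤ → Module.End ℂ V)
    (hf : ∀ u : V, ∃ N : ℤ, ∀ n : ℤ, N ≤ n → f n u = 0) : VertexOperator ℂ V :=
  VertexOperator.of_coeff (fun g => f (-g - 1)) (by
    intro u
    obtain ⟨N, hN⟩ := hf u
    refine ⟨-N, fun g hg => ?_⟩
    by_contra hlt
    exact hg (hN _ (by lia)))

@[simp]
theorem ofModes_mode (f : ℤ → Module.End ℂ V)
    (hf : ∀ u : V, ∃ N : ℤ, ∀ n : ℤ, N ≤ n → f n u = 0) (n : ℤ) :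
    (ofModes f hf)[[n]] = f n := by
  simp [ofModes]

/-- The identity field `I(z) = id`. -/
def one : VertexOperator ℂ V :=
  ofModes (fun n => if n = -1 then 1 else 0) (by
    refine fun u => ⟨0, fun n hn => ?_⟩
    rw [if_neg (by lia)]
    rfl)

/-- The divided derivative `∂^{(k)} A(z) = (1 / k!) (d / dz)^k A(z)`, whose `n`-th mode is
`binom (k - n - 1) k • A[[n - k]]`. -/
def hasse (k : ℕ) (A : VertexOperator ℂ V) : VertexOperator ℂ V :=
  ofModes (fun n => Ring.choose ((k : ℤ) - n - 1) k • A[[n - k]]) (by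
    intro u
    obtain ⟨N, hN⟩ := exists_mode_eq_zero A u
    refine ⟨N + k, fun n hn => ?_⟩
    rw [LinearMap.smul_apply, hN _ (by lia), smul_zero])

theorem finite_support_left (A B : VertexOperator ℂ V) (n : ℤ) (u : V) :
    (Function.support fun j : ℕ => (A[[-(j : ℤ) - 1]]) ((B[[n + j]]) u)).Finite := by
  obtain ⟨N, hN⟩ := exists_mode_eq_zero B u
  refine (Set.finite_Iio (N - n).toNat).subset fun j hj => ?_
  by_contra hlt
  rw [Set.mem_Iio, not_lt] at hlt
  exact hj (by simp [hN (n + j) (by lia)])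

theorem finite_support_right (A B : VertexOperator ℂ V) (n : ℤ) (u : V) :
    (Function.support fun j : ℕ => (B[[n - j - 1]]) ((A[[(j : ℤ)]]) u)).Finite := by
  obtain ⟨N, hN⟩ := exists_mode_eq_zero A u
  refine (Set.finite_Iio N.toNat).subset fun j hj => ?_
  by_contra hlt
  rw [Set.mem_Iio, not_lt] at hlt
  exact hj (by simp [hN (j : ℤ) (by lia)])

/-- The `n`-th mode of the normally ordered product
`:A(z) B(z): = A(z)₋ B(z) + B(z) A(z)₊`, where `A(z)₋` consists of the modes of negative index and
`A(z)₊` of those of non-negative index. On each vector both sums are finite. -/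
def normalOrderMode (A B : VertexOperator ℂ V) (n : ℤ) : Module.End ℂ V where
  toFun u := (∑ᶠ j : ℕ, (A[[-(j : ℤ) - 1]]) ((B[[n + j]]) u)) +
    ∑ᶠ j : ℕ, (B[[n - j - 1]]) ((A[[(j : ℤ)]]) u)
  map_add' u v := by
    simp only [map_add]
    rw [finsum_add_distrib (finite_support_left A B n u) (finite_support_left A B n v),
      finsum_add_distrib (finite_support_right A B n u) (finite_support_right A B n v)]
    abel
  map_smul' c u := by
    simp only [map_smul, RingHom.id_apply, smul_add, smul_finsum]

/-- The normally ordered product of two fields. -/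
def normalOrder (A B : VertexOperator ℂ V) : VertexOperator ℂ V :=
  ofModes (normalOrderMode A B) (by
    intro u
    obtain ⟨N, hN⟩ := exists_mode_eq_zero B u
    obtain ⟨M, hM⟩ := exists_mode_eq_zero A u
    choose K hK using fun j : ℕ => exists_mode_eq_zero B ((A[[(j : ℤ)]]) u)
    obtain ⟨L, hL⟩ := ((Finset.range M.toNat).image fun j : ℕ => K j + j + 1).bddAbove
    refine ⟨max N L, fun n hn => ?_⟩
    have h1 : ∀ j : ℕ, (A[[-(j : ℤ) - 1]]) ((B[[n + j]]) u) = 0 := fun j => by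
      rw [hN (n + j) (by lia), map_zero]
    have h2 : ∀ j : ℕ, (B[[n - j - 1]]) ((A[[(j : ℤ)]]) u) = 0 := fun j => by
      by_cases hj : j < M.toNat
      · have := hL (Finset.mem_coe.2 (Finset.mem_image_of_mem (fun j : ℕ => K j + j + 1)
          (Finset.mem_range.2 hj)))
        exact hK j _ (by lia)
      · rw [hM (j : ℤ) (by lia), map_zero]
    change (∑ᶠ j : ℕ, (A[[-(j : ℤ) - 1]]) ((B[[n + j]]) u)) +
      ∑ᶠ j : ℕ, (B[[n - j - 1]]) ((A[[(j : ℤ)]]) u) = 0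
    simp only [h1, h2, finsum_zero, add_zero])

end BosonField

/-! ### Virasoro vectors and conformal vectors

The structure of a vertex algebra on `V` is recorded by the state-field correspondence
`Y : a ↦ Y(a, z)`, with `a_(n) b = (Y a)[[n]] b`, and the vacuum vector `vac`. -/

section Vectors

variable {V : Type*} [AddCommGroup V] [Module ℂ V]

/-- The translation operator `T a = a_(-2) vac`. -/
def translation (Y : V →ₗ[ℂ] VertexOperator ℂ V) (vac : V) : Module.End ℂ V where
  toFun a := ((Y a)[[(-2 : ℤ)]]) vac
  map_add' a b := by simp
  map_smul' c a := by simp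

/-- `v` is a Virasoro vector: `v` is non-zero, and for some central charge `c` the field `Y(v, z)`
has the Virasoro operator product expansion
`Y(v, y) Y(v, z) ∼ (c / 2) / (y - z)^4 + 2 Y(v, z) / (y - z)^2 + ∂Y(v, z) / (y - z)`. -/
def IsVirasoroVector (Y : V →ₗ[ℂ] VertexOperator ℂ V) (vac v : V) : Prop :=
  v ≠ 0 ∧ ∃ c : ℂ,
    (∀ n : ℤ, 4 ≤ n → ((Y v)[[n]]) v = 0) ∧
    ((Y v)[[(3 : ℤ)]]) v = (c / 2) • vac ∧
    ((Y v)[[(2 : ℤ)]]) v = 0 ∧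
    ((Y v)[[(1 : ℤ)]]) v = (2 : ℂ) • v ∧
    ((Y v)[[(0 : ℤ)]]) v = translation Y vac v

/-- `v` is a conformal vector: a Virasoro vector such that `L₋₁ = v_(0)` is the translation
operator and `L₀ = v_(1)` is semisimple. -/
def IsConformalVector (Y : V →ₗ[ℂ] VertexOperator ℂ V) (vac v : V) : Prop :=
  IsVirasoroVector Y vac v ∧
    (Y v)[[(0 : ℤ)]] = translation Y vac ∧
    Module.End.IsSemisimple ((Y v)[[(1 : ℤ)]])

end Vectors

/-! ### The free bosonic vertex algebra -/

/-- The underlying space `ℂ[x₁, x₂, …]` of the vacuum representation of the Heisenberg algebra. -/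
abbrev Fock : Type := MvPolynomial ℕ+ ℂ

namespace FreeBoson

/-- The operators `αₙ` on `ℂ[x₁, x₂, …]`: `αₙ = n ∂/∂xₙ` for `n > 0`, `α₀ = 0`, and `αₙ` is
multiplication by `x₋ₙ` for `n < 0`. -/
def heisenberg : ℤ → Module.End ℂ Fock
  | Int.ofNat 0 => 0
  | Int.ofNat (k + 1) => ((k : ℂ) + 1) • (MvPolynomial.pderiv k.succPNat).toLinearMap
  | Int.negSucc k => LinearMap.mulLeft ℂ (MvPolynomial.X k.succPNat)

/-- The Heisenberg field `α(z) = ∑ n, αₙ z ^ (-n - 1)`. -/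
def alpha : VertexOperator ℂ Fock :=
  BosonField.ofModes heisenberg (by
    intro p
    refine ⟨(p.vars.sup fun i : ℕ+ => (i : ℕ)) + 1, fun n hn => ?_⟩
    obtain ⟨k, rfl⟩ : ∃ k : ℕ, n = Int.ofNat (k + 1) :=
      ⟨(n - 1).toNat, by simp only [Int.ofNat_eq_natCast]; lia⟩
    have hk : k.succPNat ∉ p.vars := fun h => by
      have h1 := Finset.le_sup (f := fun i : ℕ+ => (i : ℕ)) h
      simp only [Nat.succPNat_coe] at h1
      simp only [Int.ofNat_eq_natCast] at hn
      lia
    change ((k : ℂ) + 1) • MvPolynomial.pderiv k.succPNat p = 0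
    rw [MvPolynomial.pderiv_eq_zero_of_notMem_vars hk, smul_zero])

/-- The field `:∂^{(i₁ - 1)}α(z) ⋯ ∂^{(iₖ - 1)}α(z):` attached to a list `[i₁, …, iₖ]`, the
nested normally ordered product being taken from the right, and the empty product being the identity
field. -/
def monomialField (l : List ℕ+) : VertexOperator ℂ Fock :=
  l.foldr (fun i B => BosonField.normalOrder (BosonField.hasse ((i : ℕ) - 1) alpha) B)
    BosonField.one

/-- The state-field correspondence of the free bosonic vertex algebra: the linear map with
`Y(x_{i₁} ⋯ x_{iₖ}, z) = :∂^{(i₁ - 1)}α(z) ⋯ ∂^{(iₖ - 1)}α(z):` for `i₁ ≤ ⋯ ≤ iₖ`. -/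
def Y : Fock →ₗ[ℂ] VertexOperator ℂ Fock :=
  (MvPolynomial.basisMonomials ℕ+ ℂ).constr ℂ fun m =>
    monomialField ((Finsupp.toMultiset m).sort (· ≤ ·))

/-- The vacuum vector `1`. -/
def vacuum : Fock := 1

end FreeBoson

end

noncomputable section

namespace FreeBoson

open MvPolynomial

/-! Existence is a computation. Any operator that kills 1 and whose commutator with each x_i is
multiplication by a polynomial is a derivation (`eq_mkDerivation`). For every member of the family,
mode 0 is the derivation x_i ↦ i x_{i+1}, which is T, and mode 1 is the derivation x_i ↦ i x_i, with
an extra constant μ when i = 1. The latter is diagonal in the variables x_1 + μ, x_2, x_3, …, hence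
semisimple.

For uniqueness, filter by total degree. A non-negative mode involves at least one contraction, so
a_(n)u has degree at most deg a + deg u - 2 (`Y_mode_mem`). If N bounds the variable indices of a
and u, then modulo one degree less the (2N-1)-st product is a nonzero multiple of ∂_N a · ∂_N u
(`Y_pole`). Apply this to the top component w of a Virasoro vector v of degree k, with N the largest
index in w: v_(2N-1)v has degree exactly 2k-2. The Virasoro relations then force N = 1 and k = 2,
and v_(1)v = 2v gives w = x_1²/2.

The remainder has degree at most 1. Match its x_1 and x_2 coefficients by a choice of μ and λ. The
difference s from the resulting member does not affect L_0, so L_0 s = 2s; but s has no x_1 or x_2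
term, and constants and the other x_i have weights different from 2. Hence s = 0. -/

/-! ### Modes of the divided derivatives of α -/

theorem heisenberg_natCast (j : ℕ+) (u : Fock) :
    heisenberg (j : ℕ) u = ((j : ℕ) : ℂ) • pderiv j u := by
  obtain ⟨k, rfl⟩ : ∃ k : ℕ, j = k.succPNat := ⟨j.natPred, by simp⟩
  have h : (((k.succPNat : ℕ+) : ℕ) : ℤ) = Int.ofNat (k + 1) := rfl
  rw [h]
  simp [heisenberg]

theorem heisenberg_neg (j : ℕ+) (u : Fock) : heisenberg (-((j : ℕ) : ℤ)) u = X j * u := by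
  obtain ⟨k, rfl⟩ : ∃ k : ℕ, j = k.succPNat := ⟨j.natPred, by simp⟩
  have h : -(((k.succPNat : ℕ+) : ℕ) : ℤ) = Int.negSucc k := rfl
  rw [h]
  simp [heisenberg]

@[simp]
theorem heisenberg_zero : heisenberg 0 = 0 := rfl

@[simp]
theorem alpha_mode (n : ℤ) : alpha[[n]] = heisenberg n := by simp [alpha]

theorem hasse_alpha_mode (k : ℕ) (n : ℤ) (u : Fock) :
    ((BosonField.hasse k alpha)[[n]]) u =
      Ring.choose ((k : ℤ) - n - 1) k • heisenberg (n - k) u := by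
  simp [BosonField.hasse]

theorem hasse_alpha_neg (k j : ℕ) (u : Fock) :
    ((BosonField.hasse k alpha)[[-(j : ℤ) - 1]]) u =
      ((k + j).choose k) • (X (k + j).succPNat * u) := by
  rw [hasse_alpha_mode]
  have h1 : (k : ℤ) - (-(j : ℤ) - 1) - 1 = ((k + j : ℕ) : ℤ) := by push_cast; ring
  have h2 : -(j : ℤ) - 1 - k = -(((k + j).succPNat : ℕ) : ℤ) := by
    rw [Nat.succPNat_coe]; push_cast; ring
  rw [h1, h2, heisenberg_neg, Ring.choose_natCast, natCast_zsmul]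

theorem hasse_alpha_neg_one (i : ℕ+) (u : Fock) :
    ((BosonField.hasse ((i : ℕ) - 1) alpha)[[(-1 : ℤ)]]) u = X i * u := by
  have h := hasse_alpha_neg ((i : ℕ) - 1) 0 u
  have h2 : ((i : ℕ) - 1).succPNat = i := PNat.succPNat_natPred i
  simpa [h2] using h

theorem hasse_alpha_neg_two (i : ℕ+) (u : Fock) :
    ((BosonField.hasse ((i : ℕ) - 1) alpha)[[(-2 : ℤ)]]) u = (i : ℕ) • (X (i + 1) * u) := by
  have h := hasse_alpha_neg ((i : ℕ) - 1) 1 u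
  have hi := i.pos
  have h2 : ((i : ℕ) - 1 + 1).succPNat = i + 1 := by
    apply PNat.coe_injective; rw [Nat.succPNat_coe, PNat.add_coe, PNat.one_coe]; lia
  have h3 : ((i : ℕ) - 1 + 1).choose ((i : ℕ) - 1) = i := by
    rw [Nat.choose_succ_self_right]; lia
  rw [h2, h3] at h
  simpa using h

/-- The annihilation modes of `∂^{(k)} α(z)` are multiples of partial derivatives. -/
theorem hasse_alpha_nonneg (k : ℕ) (j : ℕ) (u : Fock) :
    (((BosonField.hasse k alpha)[[(j : ℤ)]]) u = 0) ∨
    ∃ i : ℕ+, j = k + (i : ℕ) ∧ ((BosonField.hasse k alpha)[[(j : ℤ)]]) u =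
      (Ring.choose ((k : ℤ) - j - 1) k * (i : ℕ) : ℤ) • pderiv i u := by
  rcases lt_trichotomy j k with h | rfl | h
  · left
    rw [hasse_alpha_mode]
    have h1 : (k : ℤ) - j - 1 = ((k - j - 1 : ℕ) : ℤ) := by lia
    rw [h1, Ring.choose_natCast, Nat.choose_eq_zero_of_lt (by lia)]
    simp
  · left
    simp [hasse_alpha_mode]
  · right
    obtain ⟨i, hi⟩ : ∃ i : ℕ+, (i : ℕ) = j - k := ⟨⟨j - k, by lia⟩, rfl⟩
    refine ⟨i, by lia, ?_⟩
    have h1 : (j : ℤ) - k = ((i : ℕ) : ℤ) := by lia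
    rw [hasse_alpha_mode, h1, heisenberg_natCast, mul_smul]
    simp [Nat.cast_smul_eq_nsmul ℂ]

/-- The constant in the highest pole of `∂^{(N-1)}α(z) ∂^{(N-1)}α(w)`. -/
def poleCoeff (N : ℕ+) : ℤ := Ring.choose (-((N : ℕ) : ℤ) - 1) ((N : ℕ) - 1) * (N : ℕ)

/-- Upper negation turns the binomial coefficient into ± binom(2N-1, N-1). -/
theorem poleCoeff_ne_zero (N : ℕ+) : poleCoeff N ≠ 0 := by
  have h : -((N : ℕ) : ℤ) - 1 = -(((N : ℕ) + 1 : ℕ) : ℤ) := by push_cast; ring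
  have hN := N.pos
  have h2 : (((N : ℕ) + 1 : ℕ) : ℤ) + (((N : ℕ) - 1 : ℕ) : ℤ) - 1 = ((2 * (N : ℕ) - 1 : ℕ) : ℤ) := by
    lia
  rw [poleCoeff, h, Ring.choose_neg, h2, Ring.choose_natCast]
  have h3 : (2 * (N : ℕ) - 1).choose ((N : ℕ) - 1) ≠ 0 :=
    (Nat.choose_pos (by lia)).ne'
  refine mul_ne_zero ?_ (by exact_mod_cast N.ne_zero)
  rw [Units.smul_def, smul_eq_mul]
  exact mul_ne_zero (Units.ne_zero _) (by exact_mod_cast h3)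

@[simp]
theorem poleCoeff_one : poleCoeff 1 = 1 := by simp [poleCoeff]

/-- The j-th mode is a multiple of ∂/∂x_l with l = j - i + 1. Here l ≥ N, with equality only when j
= 2N-1 and i = N; a larger l kills u. -/
theorem hasse_alpha_pole {i N : ℕ+} (hi : i ≤ N) (j : ℕ) (hj : 2 * (N : ℕ) - 1 ≤ j) (u : Fock)
    (hu : ∀ l : ℕ+, N < l → pderiv l u = 0) :
    ((BosonField.hasse ((i : ℕ) - 1) alpha)[[(j : ℤ)]]) u =
      if j = 2 * (N : ℕ) - 1 ∧ i = N then poleCoeff N • pderiv N u else 0 := by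
  have hN := N.pos
  have hi0 := i.pos
  have hi' : (i : ℕ) ≤ N := hi
  split_ifs with h
  · obtain ⟨rfl, rfl⟩ := h
    rw [hasse_alpha_mode]
    have h1 : ((2 * (i : ℕ) - 1 : ℕ) : ℤ) - (((i : ℕ) - 1 : ℕ) : ℤ) = (i : ℕ) := by lia
    have h2 : (((i : ℕ) - 1 : ℕ) : ℤ) - ((2 * (i : ℕ) - 1 : ℕ) : ℤ) - 1 = -((i : ℕ) : ℤ) - 1 := by lia
    rw [h1, h2, heisenberg_natCast, poleCoeff, mul_smul]
    simp [Nat.cast_smul_eq_nsmul ℂ]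
  · rcases hasse_alpha_nonneg ((i : ℕ) - 1) j u with h0 | ⟨l, hl, h0⟩
    · exact h0
    · rw [h0, hu l, smul_zero]
      by_contra hl'
      have hl' : (l : ℕ) ≤ N := not_lt.1 hl'
      refine h ⟨by lia, PNat.coe_injective (by lia)⟩

/-! ### The filtration by total degree -/

/-- The polynomials of total degree at most `d`. -/
def degLE (d : ℤ) : Submodule ℂ Fock where
  carrier := {p | ∀ m, coeff m p ≠ 0 → (m.degree : ℤ) ≤ d}
  add_mem' {p q} hp hq m hm := by
    by_cases h : coeff m p = 0
    · exact hq m fun h' => hm (by rw [coeff_add, h, h', add_zero])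
    · exact hp m h
  zero_mem' m hm := absurd (coeff_zero m) hm
  smul_mem' c p hp m hm := hp m fun h => hm (by rw [coeff_smul, h, smul_zero])

theorem mem_degLE {d : ℤ} {p : Fock} :
    p ∈ degLE d ↔ ∀ m, coeff m p ≠ 0 → (m.degree : ℤ) ≤ d := Iff.rfl

theorem degLE_mono {d e : ℤ} (h : d ≤ e) : degLE d ≤ degLE e :=
  fun _ hp m hm => (hp m hm).trans h

theorem mem_degLE_of_le {d e : ℤ} {p : Fock} (hp : p ∈ degLE d) (h : d ≤ e) : p ∈ degLE e :=
  degLE_mono h hp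

theorem X_mul_mem_degLE {d : ℤ} {p : Fock} (hp : p ∈ degLE d) (i : ℕ+) :
    X i * p ∈ degLE (d + 1) := by
  intro m hm
  rw [coeff_X_mul'] at hm
  split_ifs at hm with h
  · have := hp _ hm
    have h1 : m = (m - Finsupp.single i 1) + Finsupp.single i 1 := by
      rw [tsub_add_cancel_of_le]
      rw [Finsupp.single_le_iff]
      exact Nat.one_le_iff_ne_zero.2 (Finsupp.mem_support_iff.1 h)
    rw [h1, map_add, Finsupp.degree_single]
    push_cast
    lia
  · exact absurd rfl hm

/-- The integer index keeps d - 1 from being truncated: constants land in `degLE (-1)`, which is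
zero. -/
theorem pderiv_mem_degLE {d : ℤ} {p : Fock} (hp : p ∈ degLE d) (i : ℕ+) :
    pderiv i p ∈ degLE (d - 1) := by
  intro m hm
  rw [coeff_pderiv] at hm
  have := hp _ (left_ne_zero_of_mul hm)
  rw [map_add, Finsupp.degree_single] at this
  push_cast at this
  lia

theorem hasse_alpha_neg_mem {d : ℤ} {p : Fock} (hp : p ∈ degLE d) (k j : ℕ) :
    ((BosonField.hasse k alpha)[[-(j : ℤ) - 1]]) p ∈ degLE (d + 1) := by
  rw [hasse_alpha_neg, ← Nat.cast_smul_eq_nsmul ℂ]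
  exact Submodule.smul_mem _ _ (X_mul_mem_degLE hp _)

theorem hasse_alpha_nonneg_mem {d : ℤ} {p : Fock} (hp : p ∈ degLE d) (k j : ℕ) :
    ((BosonField.hasse k alpha)[[(j : ℤ)]]) p ∈ degLE (d - 1) := by
  rcases hasse_alpha_nonneg k j p with h | ⟨i, -, h⟩
  · rw [h]; exact Submodule.zero_mem _
  · rw [h, ← Int.cast_smul_eq_zsmul ℂ]
    exact Submodule.smul_mem _ _ (pderiv_mem_degLE hp _)

theorem finsum_mem_degLE {ι : Type*} {d : ℤ} {f : ι → Fock} (h : ∀ i, f i ∈ degLE d) :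
    ∑ᶠ i, f i ∈ degLE d :=
  finsum_induction (· ∈ degLE d) (Submodule.zero_mem _) (fun _ _ => Submodule.add_mem _) h

end FreeBoson

/-! ### Modes of normally ordered products -/

namespace BosonField

variable {V : Type*} [AddCommGroup V] [Module ℂ V]

theorem normalOrder_mode (A B : VertexOperator ℂ V) (n : ℤ) (u : V) :
    ((normalOrder A B)[[n]]) u = (∑ᶠ j : ℕ, (A[[-(j : ℤ) - 1]]) ((B[[n + j]]) u)) +
      ∑ᶠ j : ℕ, (B[[n - j - 1]]) ((A[[(j : ℤ)]]) u) := by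
  rw [normalOrder, ofModes_mode]
  rfl

theorem one_mode (n : ℤ) (u : V) : ((one : VertexOperator ℂ V)[[n]]) u = if n = -1 then u else 0 := by
  rw [one, ofModes_mode]
  split_ifs <;> rfl

theorem ext_modes {A B : VertexOperator ℂ V} (h : ∀ (n : ℤ) (u : V), (A[[n]]) u = (B[[n]]) u) :
    A = B := by
  refine VertexOperator.ext _ _ fun u => ?_
  apply (HahnModule.of ℂ).symm.injective
  ext n
  have := h (-n - 1) u
  rwa [← VertexOperator.coeff_eq_ncoeff, ← VertexOperator.coeff_eq_ncoeff] at this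

theorem normalOrder_one (A : VertexOperator ℂ V) : normalOrder A one = A := by
  refine ext_modes fun n u => ?_
  rw [normalOrder_mode]
  simp only [one_mode]
  rcases lt_or_ge n 0 with h | h
  · rw [finsum_eq_single _ (-n - 1).toNat, if_pos (by lia)]
    · rw [finsum_eq_zero_of_forall_eq_zero, add_zero]
      · rw [show -(((-n - 1).toNat : ℕ) : ℤ) - 1 = n by lia]
      · intro j; rw [if_neg (by lia)]
    · intro j hj; rw [if_neg (by lia), map_zero]
  · rw [finsum_eq_zero_of_forall_eq_zero, zero_add, finsum_eq_single _ n.toNat, if_pos (by lia)]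
    · rw [show ((n.toNat : ℕ) : ℤ) = n by lia]
    · intro j hj; rw [if_neg (by lia)]
    · intro j; rw [if_neg (by lia), map_zero]

@[simp]
theorem hasse_zero (A : VertexOperator ℂ V) : hasse 0 A = A := by
  refine ext_modes fun n u => ?_
  simp [hasse]

end BosonField

/-! ### Leading terms of the modes of monomial fields -/

namespace FreeBoson

open MvPolynomial

theorem monomialField_cons (i : ℕ+) (l : List ℕ+) :
    monomialField (i :: l) =
      BosonField.normalOrder (BosonField.hasse ((i : ℕ) - 1) alpha) (monomialField l) := rfl

theorem monomialField_nil : monomialField [] = BosonField.one := rfl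

/-- Isolates the single leading summand of a normally ordered sum. -/
theorem finsum_sub_mem_degLE {d : ℤ} {f : ℕ → Fock} (a : ℕ) {p : Fock}
    (hf : f.support.Finite) (h0 : f a - p ∈ degLE d) (h : ∀ j, j ≠ a → f j ∈ degLE d) :
    ∑ᶠ j, f j - p ∈ degLE d := by
  have h1 : ∑ᶠ j, f j = f a + ∑ᶠ j, if j = a then 0 else f j := by
    have h2 : (Function.support fun j => if j = a then f a else 0).Finite :=
      (Set.finite_singleton a).subset fun j hj => by
        by_contra hja
        exact hj (if_neg hja)
    have h3 : (Function.support fun j => if j = a then 0 else f j).Finite :=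
      hf.subset fun j hj => by
        rw [Function.mem_support] at hj ⊢
        split_ifs at hj with h
        · exact absurd rfl hj
        · exact hj
    have h4 : f a = ∑ᶠ j, if j = a then f a else 0 := by
      rw [finsum_eq_single _ a fun j hj => if_neg hj, if_pos rfl]
    conv_rhs => rw [h4, ← finsum_add_distrib h2 h3]
    refine finsum_congr fun j => ?_
    by_cases hj : j = a <;> simp [hj]
  rw [h1, add_sub_right_comm]
  refine Submodule.add_mem _ h0 (finsum_mem_degLE fun j => ?_)
  split_ifs with hj
  · exact Submodule.zero_mem _
  · exact h j hj

/-- Each factor raises the degree by one if it creates and lowers it by one if it annihilates. A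
non-negative mode needs an annihilator, costing 2; in mode -1 the only term without one is plain
multiplication. The bounds are proved together, for all u, because the induction applies the tail to
the result of an annihilation. -/
theorem monomialField_mode_mem (l : List ℕ+) :
    ∀ {d : ℤ} {u : Fock}, u ∈ degLE d →
      (∀ n : ℤ, ((monomialField l)[[n]]) u ∈ degLE (l.length + d)) ∧
      (∀ n : ℕ, ((monomialField l)[[(n : ℤ)]]) u ∈ degLE (l.length + d - 2)) ∧
      ((monomialField l)[[(-1 : ℤ)]]) u - (l.map X).prod * u ∈ degLE (l.length + d - 2) := by
  induction l with
  | nil =>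
    intro d u hu
    refine ⟨fun n => ?_, fun n => ?_, ?_⟩
    · rw [monomialField_nil, BosonField.one_mode]
      split_ifs
      · simpa using hu
      · exact Submodule.zero_mem _
    · rw [monomialField_nil, BosonField.one_mode, if_neg (by lia)]
      exact Submodule.zero_mem _
    · rw [monomialField_nil, BosonField.one_mode, if_pos rfl]
      simp
  | cons i l ih =>
    intro d u hu
    have hlen : (((i :: l).length : ℕ) : ℤ) = l.length + 1 := by simp
    rw [hlen, monomialField_cons]
    set B := monomialField l
    refine ⟨fun n => ?_, fun n => ?_, ?_⟩
    · rw [BosonField.normalOrder_mode]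
      refine Submodule.add_mem _ (finsum_mem_degLE fun j => ?_) (finsum_mem_degLE fun j => ?_)
      · exact mem_degLE_of_le (hasse_alpha_neg_mem ((ih hu).1 _) _ _) (by lia)
      · exact mem_degLE_of_le ((ih (hasse_alpha_nonneg_mem hu _ _)).1 _) (by lia)
    · rw [BosonField.normalOrder_mode]
      refine Submodule.add_mem _ (finsum_mem_degLE fun j => ?_) (finsum_mem_degLE fun j => ?_)
      · exact mem_degLE_of_le (hasse_alpha_neg_mem ((ih hu).2.1 (n + j)) _ _) (by lia)
      · exact mem_degLE_of_le ((ih (hasse_alpha_nonneg_mem hu _ _)).1 _) (by lia)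
    · rw [BosonField.normalOrder_mode, add_sub_right_comm _ _ (List.prod _ * u)]
      refine Submodule.add_mem _ (finsum_sub_mem_degLE 0
        (BosonField.finite_support_left (BosonField.hasse ((i : ℕ) - 1) alpha) B (-1) u) ?_
        fun j hj => ?_) (finsum_mem_degLE fun j => ?_)
      · simp only [Nat.cast_zero, neg_zero, zero_sub, add_zero]
        rw [hasse_alpha_neg_one, List.map_cons, List.prod_cons, mul_assoc, ← mul_sub]
        exact mem_degLE_of_le (X_mul_mem_degLE (ih hu).2.2 i) (by lia)
      · obtain ⟨k, rfl⟩ : ∃ k, j = k + 1 := ⟨j - 1, by lia⟩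
        have h1 : (-1 : ℤ) + ((k + 1 : ℕ) : ℤ) = (k : ℤ) := by push_cast; ring
        rw [h1]
        exact mem_degLE_of_le (hasse_alpha_neg_mem ((ih hu).2.1 k) _ _) (by lia)
      · exact mem_degLE_of_le ((ih (hasse_alpha_nonneg_mem hu _ _)).1 _) (by lia)

/-- Only terms with exactly one contraction matter in this degree. In a mode this high the
contracted factor must have index N and act on u by ∂_N; summing over the factors is the Leibniz
rule for ∂_N of the monomial. -/
theorem monomialField_pole (N : ℕ+) (l : List ℕ+) (hl : ∀ i ∈ l, i ≤ N) {d : ℤ} {u : Fock}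
    (hu : u ∈ degLE d) (huN : ∀ i : ℕ+, N < i → pderiv i u = 0) (n : ℕ)
    (hn : 2 * (N : ℕ) - 1 ≤ n) :
    ((monomialField l)[[(n : ℤ)]]) u -
      (if n = 2 * (N : ℕ) - 1 then
        poleCoeff N • (pderiv N (l.map X).prod * pderiv N u) else 0) ∈
      degLE (l.length + d - 3) := by
  have hN := N.pos
  induction l generalizing n with
  | nil =>
    rw [monomialField_nil, BosonField.one_mode, if_neg (by lia)]
    simp
  | cons i l ih =>
    have hlen : (((i :: l).length : ℕ) : ℤ) = l.length + 1 := by simp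
    have hi : i ≤ N := hl i (by simp)
    have ih := ih fun j hj => hl j (by simp [hj])
    rw [hlen, monomialField_cons, BosonField.normalOrder_mode]
    -- Leibniz: the first summand contracts a factor of the tail (left sum, j = 0), the second
    -- contracts the head (right sum, j = n).
    have key : (if n = 2 * (N : ℕ) - 1 then
        poleCoeff N • (pderiv N ((i :: l).map X).prod * pderiv N u) else 0) =
        X i * (if n = 2 * (N : ℕ) - 1 then
          poleCoeff N • (pderiv N (l.map X).prod * pderiv N u) else 0) +
        (l.map X).prod * (if n = 2 * (N : ℕ) - 1 ∧ i = N then poleCoeff N • pderiv N u else 0) := by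
      by_cases h : n = 2 * (N : ℕ) - 1
      · by_cases h' : i = N
        · subst h'
          simp [h]
          ring
        · simp [h, h', pderiv_X_of_ne h']
          ring
      · simp [h]
    rw [key, add_sub_add_comm]
    refine Submodule.add_mem _ (finsum_sub_mem_degLE 0
        (BosonField.finite_support_left _ _ _ _) ?_ fun j hj => ?_)
        (finsum_sub_mem_degLE n (BosonField.finite_support_right _ _ _ _) ?_ fun j hj => ?_)
    · simp only [Nat.cast_zero, neg_zero, zero_sub, add_zero]
      rw [hasse_alpha_neg_one, ← mul_sub]
      exact mem_degLE_of_le (X_mul_mem_degLE (ih n hn) i) (by lia)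
    -- For j > 0 the tail is in a mode beyond 2N-1, where its leading term vanishes.
    · have h1 := ih (n + j) (by lia)
      rw [if_neg (by lia), sub_zero] at h1
      push_cast at h1
      exact mem_degLE_of_le (hasse_alpha_neg_mem h1 _ _) (by lia)
    · have h1 : (n : ℤ) - n - 1 = -1 := by ring
      rw [h1, ← hasse_alpha_pole hi n hn u huN]
      exact mem_degLE_of_le
        ((monomialField_mode_mem l (hasse_alpha_nonneg_mem hu _ _)).2.2) (by lia)
    -- For j < n the tail is in a non-negative mode and contracts a second time; for j > n the head
    -- kills u.
    · rcases lt_or_gt_of_ne hj with h | h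
      · have h1 : (n : ℤ) - j - 1 = ((n - j - 1 : ℕ) : ℤ) := by lia
        rw [h1]
        exact mem_degLE_of_le
          ((monomialField_mode_mem l (hasse_alpha_nonneg_mem hu _ _)).2.1 _) (by lia)
      · rw [hasse_alpha_pole hi j (by lia) u huN, if_neg (by lia), map_zero]
        exact Submodule.zero_mem _

/-! ### The state-field correspondence on monomials -/

theorem Y_monomial (m : ℕ+ →₀ ℕ) (c : ℂ) :
    Y (monomial m c) = c • monomialField ((Finsupp.toMultiset m).sort (· ≤ ·)) := by
  have h : monomial m c = c • (basisMonomials ℕ+ ℂ) m := by simp [smul_monomial]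
  rw [h, map_smul, Y, Module.Basis.constr_basis]

theorem Y_apply (a : Fock) : Y a = ∑ m ∈ a.support,
    coeff m a • monomialField ((Finsupp.toMultiset m).sort (· ≤ ·)) := by
  conv_lhs => rw [a.as_sum, map_sum]
  exact Finset.sum_congr rfl fun m _ => Y_monomial m _

theorem Y_mode (a : Fock) (n : ℤ) (u : Fock) : ((Y a)[[n]]) u = ∑ m ∈ a.support,
    coeff m a • ((monomialField ((Finsupp.toMultiset m).sort (· ≤ ·)))[[n]]) u := by
  rw [Y_apply, map_sum, Finset.sum_apply, LinearMap.sum_apply]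
  simp

theorem prod_sort_X (m : ℕ+ →₀ ℕ) :
    (((Finsupp.toMultiset m).sort (· ≤ ·)).map X).prod = (monomial m 1 : Fock) := by
  have h : ((((Finsupp.toMultiset m).sort (· ≤ ·)).map X).prod : Fock) =
      ((Finsupp.toMultiset m).map X).prod := by
    rw [← Multiset.prod_coe, ← Multiset.map_coe, Multiset.sort_eq]
  rw [h, Finsupp.toMultiset_map, Finsupp.prod_toMultiset, monomial_eq]
  rw [Finsupp.prod_mapDomain_index (by simp) (by intros; rw [pow_add])]
  simp

theorem length_sort (m : ℕ+ →₀ ℕ) : ((Finsupp.toMultiset m).sort (· ≤ ·)).length = m.degree := by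
  rw [Multiset.length_sort, Finsupp.card_toMultiset]
  rfl

theorem Y_mode_mem {k d : ℤ} {a u : Fock} (ha : a ∈ degLE k) (hu : u ∈ degLE d) (n : ℕ) :
    ((Y a)[[(n : ℤ)]]) u ∈ degLE (k + d - 2) := by
  rw [Y_mode]
  refine Submodule.sum_mem _ fun m hm => Submodule.smul_mem _ _ ?_
  have h := (monomialField_mode_mem ((Finsupp.toMultiset m).sort (· ≤ ·)) hu).2.1 n
  rw [length_sort] at h
  have := ha m (mem_support_iff.1 hm)
  exact mem_degLE_of_le h (by lia)

/-- The leading part of the highest pole of the operator product of two states, with respect to the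
filtration by degree. -/
theorem Y_pole {k d : ℤ} (N : ℕ+) {a u : Fock} (ha : a ∈ degLE k) (haN : ∀ i ∈ a.vars, i ≤ N)
    (hu : u ∈ degLE d) (huN : ∀ i ∈ u.vars, i ≤ N) :
    ((Y a)[[((2 * (N : ℕ) - 1 : ℕ) : ℤ)]]) u - poleCoeff N • (pderiv N a * pderiv N u) ∈
      degLE (k + d - 3) := by
  have h1 : poleCoeff N • (pderiv N a * pderiv N u) = ∑ m ∈ a.support, coeff m a •
      poleCoeff N • (pderiv N (((Finsupp.toMultiset m).sort (· ≤ ·)).map X).prod *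
        pderiv N u) := by
    conv_lhs => rw [a.as_sum, map_sum, Finset.sum_mul, Finset.smul_sum]
    refine Finset.sum_congr rfl fun m _ => ?_
    rw [prod_sort_X, smul_comm, ← smul_mul_assoc (coeff m a), ← Derivation.map_smul, smul_monomial]
    simp
  rw [h1, Y_mode, ← Finset.sum_sub_distrib]
  refine Submodule.sum_mem _ fun m hm => ?_
  rw [← smul_sub]
  refine Submodule.smul_mem _ _ ?_
  have h := monomialField_pole N ((Finsupp.toMultiset m).sort (· ≤ ·)) (fun i hi => haN i ?_) hu
    (fun i hi => pderiv_eq_zero_of_notMem_vars fun hiu => absurd (huN i hiu) (not_le.2 hi)) _ le_rfl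
  · rw [if_pos rfl, length_sort] at h
    have := ha m (mem_support_iff.1 hm)
    exact mem_degLE_of_le h (by lia)
  · rw [Multiset.mem_sort, Finsupp.mem_toMultiset] at hi
    exact (mem_vars_iff_mem_support i).2 ⟨m, hm, hi⟩

end FreeBoson

/-- An endomorphism whose eigenvectors span is semisimple. -/
theorem Module.End.isSemisimple_of_iSup_eigenspace_eq_top {K M : Type*} [Field K] [AddCommGroup M]
    [Module K M] {f : Module.End K M} (h : ⨆ c : K, f.eigenspace c = ⊤) : f.IsSemisimple := by
  have hinv (c : K) : f.eigenspace c ∈ f.invtSubmodule := fun x hx => by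
    rw [Submodule.mem_comap]
    rw [Module.End.mem_eigenspace_iff] at hx ⊢
    rw [hx, map_smul, hx]
  let S (c : K) : Submodule (Polynomial K) (Module.AEval' f) :=
    Module.AEval.mapSubmodule K M f ⟨f.eigenspace c, hinv c⟩
  have hS (c : K) : IsSemisimpleModule (Polynomial K) (S c) := by
    have h1 : (LinearMap.restrict f (p := f.eigenspace c) (q := f.eigenspace c) (hinv c)) = algebraMap K (Module.End K (f.eigenspace c)) c := by
      ext x
      exact Module.End.mem_eigenspace_iff.1 x.2
    have h2 : Module.End.IsSemisimple
        (LinearMap.restrict f (p := f.eigenspace c) (q := f.eigenspace c) (hinv c)) := by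
      -- Semisimplicity is unchanged by subtracting a scalar, which reduces a scalar operator to
      -- zero.
      rw [h1, ← sub_zero (algebraMap K (Module.End K (f.eigenspace c)) c), ← neg_sub, zero_sub,
        neg_neg, ← Module.End.isSemisimple_sub_algebraMap_iff (μ := c), sub_self]
      exact Module.End.isSemisimple_zero
    have h3 : IsSemisimpleModule (Polynomial K) (Module.AEval' (LinearMap.restrict f (p := f.eigenspace c) (q := f.eigenspace c) (hinv c))) := h2
    exact h3.congr (Module.AEval.restrict_equiv_mapSubmodule f _ (hinv c)).symm
  refine isSemisimpleModule_of_isSemisimpleModule_submodule' hS ?_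
  rw [eq_top_iff]
  intro x _
  obtain ⟨y, rfl⟩ := (Module.AEval'.of f).surjective x
  have hy : y ∈ ⨆ c : K, f.eigenspace c := h ▸ Submodule.mem_top
  induction hy using Submodule.iSup_induction' with
  | mem c y hy =>
    exact Submodule.mem_iSup_of_mem c (by simpa [S] using hy)
  | zero => simp
  | add y z _ _ hy hz =>
    rw [map_add]
    exact Submodule.add_mem _ (hy trivial) (hz trivial)

/-! ### Commutation with creation operators -/

namespace FreeBoson

open MvPolynomial

/-- Identifies modes of quadratic fields from their commutators, without evaluating the infinite
sums. -/
theorem eq_mkDerivation {E : Module.End ℂ Fock} {g : ℕ+ → Fock} (h1 : E 1 = 0)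
    (hX : ∀ i u, E (X i * u) = X i * E u + g i * u) (u : Fock) : E u = mkDerivation ℂ g u := by
  induction u using MvPolynomial.induction_on with
  | C c => rw [C_eq_smul_one, map_smul, h1, Derivation.map_smul, Derivation.map_one_eq_zero]
  | add p q hp hq => rw [map_add, map_add, hp, hq]
  | mul_X p i hp =>
    rw [mul_comm, hX, hp, Derivation.leibniz, mkDerivation_X, smul_eq_mul, smul_eq_mul, mul_comm (g i)]

/-- The Heisenberg relation [α_m, α_{-i}] = m δ_{m,i}. -/
theorem heisenberg_X_mul (m : ℤ) (i : ℕ+) (u : Fock) :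
    heisenberg m (X i * u) = X i * heisenberg m u + if m = (i : ℕ) then (i : ℕ) • u else 0 := by
  have hi := i.pos
  rcases lt_trichotomy m 0 with h | rfl | h
  · obtain ⟨j, rfl⟩ : ∃ j : ℕ+, m = -((j : ℕ) : ℤ) :=
      ⟨(-m).toNat.toPNat', by rw [Nat.toPNat'_coe, if_pos (by lia)]; lia⟩
    rw [heisenberg_neg, heisenberg_neg, if_neg (by lia), add_zero]
    ring
  · rw [if_neg (by lia)]
    simp
  · obtain ⟨j, rfl⟩ : ∃ j : ℕ+, m = ((j : ℕ) : ℤ) :=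
      ⟨m.toNat.toPNat', by rw [Nat.toPNat'_coe, if_pos (by lia)]; lia⟩
    rw [heisenberg_natCast, heisenberg_natCast, pderiv_mul]
    by_cases hij : j = i
    · subst hij
      simp [smul_eq_C_mul]
      ring
    · have : ¬(((j : ℕ) : ℤ) = ((i : ℕ) : ℤ)) := fun h => hij (PNat.coe_injective (by lia))
      rw [if_neg this, pderiv_X_of_ne (Ne.symm hij)]
      simp [smul_eq_C_mul]
      ring

theorem heisenberg_one {m : ℤ} (h : 0 ≤ m) : heisenberg m 1 = 0 := by
  rcases h.eq_or_lt with rfl | h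
  · simp
  · obtain ⟨j, rfl⟩ : ∃ j : ℕ+, m = ((j : ℕ) : ℤ) :=
      ⟨m.toNat.toPNat', by rw [Nat.toPNat'_coe, if_pos (by lia)]; lia⟩
    rw [heisenberg_natCast, pderiv_one, smul_zero]

theorem finsum_add_ite {f : ℕ → Fock} (hf : f.support.Finite) (a : ℕ) (p : Fock) :
    ∑ᶠ j, (f j + if j = a then p else 0) = ∑ᶠ j, f j + p := by
  rw [finsum_add_distrib hf ((Set.finite_singleton a).subset fun j hj => by
    by_contra hja
    exact hj (if_neg hja)), finsum_eq_single _ a fun j hj => if_neg hj, if_pos rfl]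

/-- Each half of the normal ordering contributes one contraction with x_i: the left sum at j = i -
n, the right sum at j = i. The bound n ≤ 1 makes i - n a natural number and keeps the outer modes
from pairing with x_i. -/
theorem normalOrder_alpha_X_mul (n : ℕ) (hn : n ≤ 1) (i : ℕ+) (u : Fock) :
    ((BosonField.normalOrder alpha alpha)[[(n : ℤ)]]) (X i * u) =
      X i * ((BosonField.normalOrder alpha alpha)[[(n : ℤ)]]) u +
        (2 * (i : ℕ)) • heisenberg ((n : ℤ) - (i : ℕ) - 1) u := by
  have hi := i.pos
  have hl := BosonField.finite_support_left alpha alpha n u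
  have hr := BosonField.finite_support_right alpha alpha n u
  simp only [BosonField.normalOrder_mode, alpha_mode] at hl hr ⊢
  have h1 : ∀ j : ℕ, heisenberg (-(j : ℤ) - 1) (heisenberg (n + j) (X i * u)) =
      X i * heisenberg (-(j : ℤ) - 1) (heisenberg (n + j) u) +
        if j = (i : ℕ) - n then (i : ℕ) • heisenberg ((n : ℤ) - (i : ℕ) - 1) u else 0 := by
    intro j
    rw [heisenberg_X_mul, map_add, heisenberg_X_mul, if_neg (by lia), add_zero]
    by_cases h : j = (i : ℕ) - n
    · rw [if_pos (by lia), if_pos h, map_nsmul]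
      congr 4
      lia
    · rw [if_neg (by lia), if_neg h, map_zero]
  have h2 : ∀ j : ℕ, heisenberg ((n : ℤ) - j - 1) (heisenberg j (X i * u)) =
      X i * heisenberg ((n : ℤ) - j - 1) (heisenberg j u) +
        if j = (i : ℕ) then (i : ℕ) • heisenberg ((n : ℤ) - (i : ℕ) - 1) u else 0 := by
    intro j
    rw [heisenberg_X_mul, map_add, heisenberg_X_mul, if_neg (by lia), add_zero]
    by_cases h : j = (i : ℕ)
    · rw [if_pos (by lia), if_pos h, map_nsmul, h]
    · rw [if_neg (by lia), if_neg h, map_zero]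
  have hl' : (Function.support fun j : ℕ =>
      X i * heisenberg (-(j : ℤ) - 1) (heisenberg (n + j) u)).Finite :=
    hl.subset (Function.support_mul_subset_right _ _)
  have hr' : (Function.support fun j : ℕ =>
      X i * heisenberg ((n : ℤ) - j - 1) (heisenberg j u)).Finite :=
    hr.subset (Function.support_mul_subset_right _ _)
  rw [finsum_congr h1, finsum_congr h2, finsum_add_ite hl', finsum_add_ite hr',
    ← mul_finsum' _ _ hl, ← mul_finsum' _ _ hr, two_mul, add_smul]
  ring

theorem normalOrder_alpha_one (n : ℕ) :
    ((BosonField.normalOrder alpha alpha)[[(n : ℤ)]]) 1 = 0 := by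
  rw [BosonField.normalOrder_mode]
  simp only [alpha_mode]
  rw [finsum_eq_zero_of_forall_eq_zero, finsum_eq_zero_of_forall_eq_zero, add_zero]
  · intro j; rw [heisenberg_one (by lia), map_zero]
  · intro j; rw [heisenberg_one (by lia), map_zero]

/-! ### The state-field correspondence on small states and the translation operator -/

theorem Y_C (c : ℂ) : Y (C c) = c • BosonField.one := by
  rw [C_apply, Y_monomial]
  simp [monomialField]

theorem Y_X (i : ℕ+) : Y (X i) = BosonField.hasse ((i : ℕ) - 1) alpha := by
  rw [X, Y_monomial, one_smul]
  simp [monomialField, BosonField.normalOrder_one]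

theorem Y_X_one_sq : Y (X 1 ^ 2) = BosonField.normalOrder alpha alpha := by
  have h : (Finsupp.toMultiset (Finsupp.single (1 : ℕ+) 2)).sort (· ≤ ·) = [1, 1] := by
    refine (List.eq_replicate_iff (n := 2)).2 ⟨by rw [length_sort, Finsupp.degree_single], fun b hb => ?_⟩
    rw [Multiset.mem_sort, Finsupp.toMultiset_single] at hb
    exact Multiset.mem_singleton.1 (Multiset.mem_of_mem_nsmul hb)
  rw [X_pow_eq_monomial, Y_monomial, one_smul, h]
  simp [monomialField, BosonField.normalOrder_one]

/-- Non-negative modes kill the vacuum, so mode -1 keeps only j = 0 and mode -2 only j = 0 and j =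
1. The latter two terms are the two halves of the Leibniz rule. -/
theorem monomialField_one (l : List ℕ+) :
    (∀ n : ℕ, ((monomialField l)[[(n : ℤ)]]) 1 = 0) ∧
    ((monomialField l)[[(-1 : ℤ)]]) 1 = (l.map X).prod ∧
    ((monomialField l)[[(-2 : ℤ)]]) 1 =
      mkDerivation ℂ (fun i : ℕ+ => (i : ℕ) • (X (i + 1) : Fock)) (l.map X).prod := by
  induction l with
  | nil =>
    simp only [monomialField_nil, BosonField.one_mode]
    refine ⟨fun n => if_neg (by lia), by simp, by simp⟩
  | cons i l ih =>
    obtain ⟨ih0, ih1, ih2⟩ := ih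
    have hA (j : ℕ) : ((BosonField.hasse ((i : ℕ) - 1) alpha)[[(j : ℤ)]]) 1 = 0 := by
      rcases hasse_alpha_nonneg ((i : ℕ) - 1) j 1 with h | ⟨k, -, h⟩
      · exact h
      · rw [h, pderiv_one, smul_zero]
    have hR (n : ℤ) : ∑ᶠ j : ℕ, ((monomialField l)[[n - j - 1]])
        (((BosonField.hasse ((i : ℕ) - 1) alpha)[[(j : ℤ)]]) 1) = 0 :=
      finsum_eq_zero_of_forall_eq_zero fun j => by rw [hA, map_zero]
    simp only [monomialField_cons, BosonField.normalOrder_mode, hR, add_zero]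
    refine ⟨fun n => finsum_eq_zero_of_forall_eq_zero fun j => ?_, ?_, ?_⟩
    · have := ih0 (n + j)
      push_cast at this
      rw [this, map_zero]
    · rw [finsum_eq_single _ 0]
      · simp [ih1, hasse_alpha_neg_one]
      · intro j hj
        have := ih0 (j - 1)
        rw [show (-1 : ℤ) + j = ((j - 1 : ℕ) : ℤ) by lia, this, map_zero]
    · rw [finsum_eq_sum_of_support_subset (s := {0, 1})]
      · rw [Finset.sum_pair (by simp)]
        simp only [Nat.cast_zero, neg_zero, zero_sub, add_zero, Nat.cast_one,
          show (-2 : ℤ) + 1 = -1 by norm_num, show (-1 : ℤ) - 1 = -2 by norm_num]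
        rw [ih1, ih2, hasse_alpha_neg_one, hasse_alpha_neg_two, List.map_cons, List.prod_cons,
          Derivation.leibniz, mkDerivation_X, smul_eq_mul, smul_eq_mul, mul_smul_comm, mul_comm (X (i + 1))]
      · intro j hj
        by_contra hj2
        simp only [Finset.coe_insert, Finset.coe_singleton, Set.mem_insert_iff,
          Set.mem_singleton_iff, not_or] at hj2
        have := ih0 (j - 2)
        exact hj (by beta_reduce; rw [show (-2 : ℤ) + j = ((j - 2 : ℕ) : ℤ) by lia, this, map_zero])

/-- The translation operator of the free boson is a derivation. -/
theorem translation_apply (u : Fock) : translation Y vacuum u =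
    mkDerivation ℂ (fun i : ℕ+ => (i : ℕ) • (X (i + 1) : Fock)) u := by
  change ((Y u)[[(-2 : ℤ)]]) 1 = _
  rw [Y_mode]
  conv_rhs => rw [u.as_sum, map_sum]
  refine Finset.sum_congr rfl fun m _ => ?_
  rw [(monomialField_one _).2.2, prod_sort_X, ← Derivation.map_smul, smul_monomial, smul_eq_mul,
    mul_one]

/-! ### The conformal vectors -/

/-- The two-parameter family of conformal vectors. -/
def conformalVector (lam mu : ℂ) : Fock :=
  C (mu ^ 2 / 2) + mu • X 1 + (1 / 2 : ℂ) • X 1 ^ 2 + lam • X 2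

/-- The constant term contributes only to mode -1, so it is invisible here; the factor -n is
binom(-n, 1) from ∂α. -/
theorem conformalVector_mode (lam mu : ℂ) (n : ℕ) (u : Fock) :
    ((Y (conformalVector lam mu))[[(n : ℤ)]]) u = mu • heisenberg n u +
      (1 / 2 : ℂ) • ((BosonField.normalOrder alpha alpha)[[(n : ℤ)]]) u -
        (lam * n) • heisenberg (n - 1) u := by
  have h : ((BosonField.hasse 1 alpha)[[(n : ℤ)]]) u = -((n : ℂ) • heisenberg (n - 1) u) := by
    rw [hasse_alpha_mode, Ring.choose_one_right]
    simp [Nat.cast_smul_eq_nsmul ℂ]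
  have h2 : (((2 : ℕ+) : ℕ) - 1) = 1 := rfl
  simp only [conformalVector, map_add, map_smul, Y_C, Y_X, Y_X_one_sq, Pi.add_apply, Pi.smul_apply,
    LinearMap.add_apply, LinearMap.smul_apply, BosonField.one_mode, PNat.one_coe, Nat.sub_self,
    BosonField.hasse_zero, h2, h, alpha_mode]
  rw [if_neg (by lia), smul_zero, zero_add, smul_neg, smul_smul, ← sub_eq_add_neg]

/-- Neither parameter survives: μ multiplies α_0 = 0 and λ carries the factor n = 0. -/
theorem conformalVector_mode_zero (lam mu : ℂ) (u : Fock) :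
    ((Y (conformalVector lam mu))[[(0 : ℤ)]]) u =
      mkDerivation ℂ (fun i : ℕ+ => (i : ℕ) • (X (i + 1) : Fock)) u := by
  have h (u : Fock) : ((Y (conformalVector lam mu))[[(0 : ℤ)]]) u =
      (1 / 2 : ℂ) • ((BosonField.normalOrder alpha alpha)[[((0 : ℕ) : ℤ)]]) u := by
    have := conformalVector_mode lam mu 0 u
    simpa using this
  refine eq_mkDerivation ?_ (fun i u => ?_) u
  · rw [h, normalOrder_alpha_one, smul_zero]
  · rw [h, h, normalOrder_alpha_X_mul 0 (by lia)]
    have h3 : ((0 : ℕ) : ℤ) - (i : ℕ) - 1 = -(((i + 1 : ℕ+) : ℕ) : ℤ) := by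
      rw [PNat.add_coe, PNat.one_coe]; push_cast; ring
    rw [h3, heisenberg_neg, smul_add, mul_smul_comm, ← Nat.cast_smul_eq_nsmul ℂ, smul_smul,
      ← Nat.cast_smul_eq_nsmul ℂ, smul_mul_assoc]
    congr 2
    push_cast
    ring

/-- The λ term is a multiple of α_0 = 0, while μ contributes μ ∂/∂x_1. -/
theorem conformalVector_mode_one (lam mu : ℂ) (u : Fock) :
    ((Y (conformalVector lam mu))[[(1 : ℤ)]]) u =
      mkDerivation ℂ (fun i : ℕ+ => (i : ℕ) • X i + if i = 1 then C mu else 0 : ℕ+ → Fock) u := by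
  have h (u : Fock) : ((Y (conformalVector lam mu))[[(1 : ℤ)]]) u = mu • pderiv 1 u +
      (1 / 2 : ℂ) • ((BosonField.normalOrder alpha alpha)[[((1 : ℕ) : ℤ)]]) u := by
    have := conformalVector_mode lam mu 1 u
    have h1 := heisenberg_natCast 1 u
    simp only [PNat.one_coe, Nat.cast_one, one_smul] at h1
    simpa [h1] using this
  refine eq_mkDerivation ?_ (fun i u => ?_) u
  · rw [h, normalOrder_alpha_one, pderiv_one, smul_zero, smul_zero, add_zero]
  · rw [h, h, normalOrder_alpha_X_mul 1 le_rfl]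
    have h3 : ((1 : ℕ) : ℤ) - (i : ℕ) - 1 = -((i : ℕ) : ℤ) := by
      push_cast; ring
    have h4 : pderiv 1 (X i * u) = X i * pderiv 1 u + if i = 1 then u else 0 := by
      by_cases hi : i = 1
      · subst hi; simp
      · simp [hi, pderiv_X_of_ne hi]
    rw [h3, heisenberg_neg, h4, smul_add, smul_add, mul_add, mul_smul_comm, mul_smul_comm,
      ← Nat.cast_smul_eq_nsmul ℂ, smul_smul, ← Nat.cast_smul_eq_nsmul ℂ, add_mul, smul_mul_assoc]
    have h5 : (1 / 2 : ℂ) * ((2 * (i : ℕ) : ℕ) : ℂ) = (i : ℕ) := by push_cast; ring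
    have h6 : mu • (if i = 1 then u else 0) = (if i = 1 then C mu else 0) * u := by
      split_ifs <;> simp [smul_eq_C_mul]
    rw [h5, h6]
    ring

theorem isSemisimple_conformalVector_mode_one (lam mu : ℂ) :
    Module.End.IsSemisimple ((Y (conformalVector lam mu))[[(1 : ℤ)]]) := by
  set E := (Y (conformalVector lam mu))[[(1 : ℤ)]] with hE
  refine Module.End.isSemisimple_of_iSup_eigenspace_eq_top ?_
  rw [eq_top_iff]
  intro p _
  induction p using MvPolynomial.induction_on with
  | C c =>
    refine Submodule.mem_iSup_of_mem 0 ?_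
    rw [Module.End.mem_eigenspace_iff, hE, conformalVector_mode_one, derivation_C, zero_smul]
  | add p q hp hq => exact Submodule.add_mem _ (hp trivial) (hq trivial)
  | mul_X p i hp =>
    refine Submodule.iSup_induction _ (motive := fun p => p * X i ∈ ⨆ c : ℂ, E.eigenspace c)
      (hp trivial) (fun c w hw => ?_) (by simp) fun p q hp hq => ?_
    · set a : Fock := if i = 1 then C mu else 0 with ha
      -- The shifted variable is an L_0-eigenvector of weight i, so multiplying by it sends the
      -- c-eigenspace to the (c + i)-eigenspace.
      have h1 : w * X i = w * (X i + (if i = 1 then mu else 0 : ℂ) • 1) -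
          (if i = 1 then mu else 0 : ℂ) • w := by
        rw [mul_add, mul_smul_comm, mul_one, add_sub_cancel_right]
      rw [h1]
      refine Submodule.sub_mem _ (Submodule.mem_iSup_of_mem (c + (i : ℕ)) ?_)
        (Submodule.smul_mem _ _ (Submodule.mem_iSup_of_mem c hw))
      rw [Module.End.mem_eigenspace_iff, hE, conformalVector_mode_one] at hw ⊢
      rw [Derivation.leibniz, hw, map_add, Derivation.map_smul, Derivation.map_one_eq_zero,
        mkDerivation_X]
      by_cases hi : i = 1
      · simp [hi, smul_eq_C_mul]
        ring
      · simp [hi, smul_eq_C_mul]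
        ring
    · rw [add_mul]
      exact Submodule.add_mem _ hp hq

/-! ### The Virasoro relations for the family -/

theorem heisenberg_conformalVector_one (lam mu : ℂ) :
    heisenberg 1 (conformalVector lam mu) = C mu + X 1 := by
  have h1 := heisenberg_natCast 1 (conformalVector lam mu)
  simp only [PNat.one_coe, Nat.cast_one, one_smul] at h1
  rw [h1, conformalVector]
  have h : pderiv (R := ℂ) (1 : ℕ+) (X 2) = 0 := pderiv_X_of_ne (by decide)
  simp [h, smul_eq_C_mul]
  rw [← mul_assoc, ← map_ofNat C 2, ← C_mul]
  norm_num

theorem heisenberg_conformalVector_two (lam mu : ℂ) :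
    heisenberg 2 (conformalVector lam mu) = C (2 * lam) := by
  have h1 := heisenberg_natCast 2 (conformalVector lam mu)
  have h2 : (((2 : ℕ+) : ℕ) : ℤ) = 2 := rfl
  rw [h2] at h1
  rw [h1, conformalVector]
  have h : pderiv (R := ℂ) (2 : ℕ+) (X 1) = 0 := pderiv_X_of_ne (by decide)
  simp [h, smul_eq_C_mul]

theorem heisenberg_conformalVector_of_three_le (lam mu : ℂ) {n : ℤ} (hn : 3 ≤ n) :
    heisenberg n (conformalVector lam mu) = 0 := by
  obtain ⟨j, rfl⟩ : ∃ j : ℕ+, n = ((j : ℕ) : ℤ) :=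
    ⟨n.toNat.toPNat', by rw [Nat.toPNat'_coe, if_pos (by lia)]; lia⟩
  have h1 : pderiv (R := ℂ) j (X 1) = 0 := pderiv_X_of_ne (by rintro rfl; simp at hn)
  have h2 : pderiv (R := ℂ) j (X 2) = 0 := pderiv_X_of_ne (by rintro rfl; revert hn; decide)
  rw [heisenberg_natCast, conformalVector]
  simp [h1, h2]

theorem heisenberg_C {n : ℤ} (hn : 0 ≤ n) (c : ℂ) : heisenberg n (C c) = 0 := by
  rw [C_eq_smul_one, map_smul, heisenberg_one hn, smul_zero]

/-- Only α_1 and α_2 among the α_j with j ≥ 0 can act nontrivially on the vector. Since n ≥ 2, the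
left sum reduces to j = 0 and the right sum to j = 1, 2. -/
theorem normalOrder_alpha_conformalVector (lam mu : ℂ) (n : ℤ) (hn : 2 ≤ n) :
    ((BosonField.normalOrder alpha alpha)[[n]]) (conformalVector lam mu) =
      heisenberg (-1) (heisenberg n (conformalVector lam mu)) +
      (heisenberg (n - 2) (C mu + X 1) + heisenberg (n - 3) (C (2 * lam))) := by
  rw [BosonField.normalOrder_mode]
  simp only [alpha_mode]
  congr 1
  · rw [finsum_eq_single _ 0]
    · simp
    · intro j hj
      rw [heisenberg_conformalVector_of_three_le _ _ (by lia), map_zero]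
  · rw [finsum_eq_sum_of_support_subset (s := {1, 2})]
    · rw [Finset.sum_pair (by simp)]
      rw [Nat.cast_one, Nat.cast_ofNat, heisenberg_conformalVector_one,
        heisenberg_conformalVector_two, sub_sub, sub_sub]
      norm_num
    · intro j hj
      by_contra hj2
      simp only [Finset.coe_insert, Finset.coe_singleton, Set.mem_insert_iff,
        Set.mem_singleton_iff, not_or] at hj2
      apply hj
      beta_reduce
      rcases Nat.eq_zero_or_pos j with rfl | h
      · simp
      · rw [heisenberg_conformalVector_of_three_le _ _ (by lia), map_zero]

theorem heisenberg_X_one {n : ℤ} (hn : 0 ≤ n) :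
    heisenberg n (X 1) = if n = 1 then 1 else 0 := by
  have h := heisenberg_X_mul n 1 1
  rw [mul_one, heisenberg_one hn] at h
  simpa using h

theorem conformalVector_ne_zero (lam mu : ℂ) : conformalVector lam mu ≠ 0 := by
  intro h
  have h1 := heisenberg_conformalVector_one lam mu
  rw [h, map_zero] at h1
  have h2 := congrArg (heisenberg 1) h1
  rw [map_zero, map_add, heisenberg_C (by lia), heisenberg_X_one (by lia)] at h2
  simp at h2

theorem isVirasoroVector_conformalVector (lam mu : ℂ) :
    IsVirasoroVector Y vacuum (conformalVector lam mu) := by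
  -- In mode 3 the quadratic part gives 1/2 and the λ part gives -3λ · 2λ; their sum is c/2.
  refine ⟨conformalVector_ne_zero lam mu, 1 - 12 * lam ^ 2, fun n hn => ?_, ?_, ?_, ?_, ?_⟩
  · obtain ⟨n, rfl⟩ := Int.eq_ofNat_of_zero_le (by lia : 0 ≤ n)
    rw [conformalVector_mode, normalOrder_alpha_conformalVector _ _ _ (by lia),
      heisenberg_conformalVector_of_three_le _ _ (by lia),
      heisenberg_conformalVector_of_three_le _ _ (by lia), map_add, heisenberg_C (by lia),
      heisenberg_C (by lia), heisenberg_X_one (by lia), if_neg (by lia)]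
    simp
  · have h := conformalVector_mode lam mu 3 (conformalVector lam mu)
    rw [normalOrder_alpha_conformalVector _ _ _ (by lia),
      heisenberg_conformalVector_of_three_le _ _ (by lia), map_add, heisenberg_C (by lia),
      heisenberg_C (by lia), heisenberg_X_one (by lia), if_pos (by lia)] at h
    have h2 : ((3 : ℕ) : ℤ) - 1 = 2 := by norm_num
    rw [h2, heisenberg_conformalVector_two] at h
    refine h.trans ?_
    simp only [vacuum, smul_eq_C_mul, mul_one, smul_zero, map_zero, zero_add, add_zero,
      ← C_mul, ← C_sub]
    congr 1
    push_cast
    ring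
  · have h := conformalVector_mode lam mu 2 (conformalVector lam mu)
    rw [normalOrder_alpha_conformalVector _ _ _ (by lia)] at h
    have h2 : ((2 : ℕ) : ℤ) - 1 = 1 := by norm_num
    have h3 : ((2 : ℕ) : ℤ) - 2 = 0 := by norm_num
    have h4 : ((2 : ℕ) : ℤ) - 3 = -1 := by norm_num
    have h5 (u : Fock) : heisenberg (-1) u = X 1 * u := heisenberg_neg 1 u
    rw [h2, h3, h4, Nat.cast_ofNat, heisenberg_conformalVector_two, heisenberg_conformalVector_one,
      heisenberg_zero, h5] at h
    refine h.trans ?_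
    simp only [smul_eq_C_mul, LinearMap.zero_apply, zero_add, C_mul, map_ofNat, Nat.cast_ofNat]
    have h6 : (C (1 / 2 : ℂ) : Fock) * 2 = 1 := by
      rw [← map_ofNat C 2, ← C_mul]; norm_num
    linear_combination (2 * C lam * X 1) * h6
  -- The vector is (x_1 + μ)²/2 + λ x_2, and x_1 + μ and x_2 have weights 1 and 2. The constant μ²/2
  -- completes the square.
  · rw [conformalVector_mode_one, conformalVector]
    have h6 : (C (1 / 2 : ℂ) : Fock) * 2 = 1 := by
      rw [← map_ofNat C 2, ← C_mul]; norm_num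
    have h7 : (C (mu ^ 2 / 2) : Fock) = C (1 / 2 : ℂ) * C mu ^ 2 := by
      rw [← C_pow, ← C_mul]; congr 1; ring
    have h8 : (2 : ℕ+) ≠ 1 := by decide
    have h9 : (C 2 : Fock) = 2 := map_ofNat C 2
    simp [h7, smul_eq_C_mul, h8, h9, -one_div]
    linear_combination (X 1 * C mu) * h6 - (C mu ^ 2) * h6
  · rw [conformalVector_mode_zero, translation_apply]

theorem isConformalVector_conformalVector (lam mu : ℂ) :
    IsConformalVector Y vacuum (conformalVector lam mu) :=
  ⟨isVirasoroVector_conformalVector lam mu,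
    LinearMap.ext fun u => by rw [conformalVector_mode_zero, translation_apply],
    isSemisimple_conformalVector_mode_one lam mu⟩

/-! ### Top homogeneous components and the quadratic part -/

theorem totalDegree_mem_degLE (v : Fock) : v ∈ degLE v.totalDegree := fun m hm => by
  exact_mod_cast le_totalDegree (mem_support_iff.2 hm)

theorem homogeneousComponent_mem_degLE (k : ℕ) (v : Fock) :
    homogeneousComponent k v ∈ degLE k := fun m hm => by
  rw [coeff_homogeneousComponent] at hm
  by_contra h
  exact hm (if_neg (by lia))

theorem sub_homogeneousComponent_mem_degLE {k : ℕ} {v : Fock} (hv : v ∈ degLE k) :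
    v - homogeneousComponent k v ∈ degLE (k - 1) := fun m hm => by
  rw [coeff_sub, coeff_homogeneousComponent] at hm
  split_ifs at hm with h
  · simp at hm
  · have := hv m (by simpa using hm)
    lia

theorem homogeneousComponent_eq_zero_of_mem_degLE {k : ℕ} {v : Fock} (hv : v ∈ degLE (k - 1)) :
    homogeneousComponent k v = 0 := by
  ext m
  rw [coeff_homogeneousComponent, coeff_zero]
  split_ifs with h
  · by_contra h'
    have := hv m h'
    lia
  · rfl

theorem homogeneousComponent_totalDegree_ne_zero {v : Fock} (hv : v ≠ 0) :
    homogeneousComponent v.totalDegree v ≠ 0 := by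
  obtain ⟨m, hm, hd⟩ := Finset.exists_mem_eq_sup v.support (support_nonempty.2 hv)
    fun m => m.sum fun _ e => e
  intro h
  have h2 := congrArg (coeff m) h
  rw [coeff_homogeneousComponent, coeff_zero, if_pos] at h2
  · exact mem_support_iff.1 hm h2
  · exact hd.symm

theorem degree_eq_of_isHomogeneous {k : ℕ} {p : Fock} (hp : p.IsHomogeneous k) {m : ℕ+ →₀ ℕ}
    (hm : coeff m p ≠ 0) : m.degree = k :=
  (DFunLike.congr_fun Finsupp.degree_eq_weight_one m).trans (hp hm)

theorem notMem_degLE_of_isHomogeneous {k : ℕ} {p : Fock} (hp : p.IsHomogeneous k) (h0 : p ≠ 0)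
    {d : ℤ} (hd : d < k) : p ∉ degLE d := fun h => by
  obtain ⟨m, hm⟩ := exists_coeff_ne_zero h0
  have h1 := h m hm
  have h2 := degree_eq_of_isHomogeneous hp hm
  lia

theorem pderiv_ne_zero_of_mem_vars {p : Fock} {i : ℕ+} (hi : i ∈ p.vars) : pderiv i p ≠ 0 := by
  obtain ⟨m, hm, him⟩ := (mem_vars_iff_mem_support i).1 hi
  intro h
  have h1 := congrArg (coeff (m - Finsupp.single i 1)) h
  have h2 : m - Finsupp.single i 1 + Finsupp.single i 1 = m := by
    rw [tsub_add_cancel_of_le]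
    rw [Finsupp.single_le_iff]
    exact Nat.one_le_iff_ne_zero.2 (Finsupp.mem_support_iff.1 him)
  rw [coeff_pderiv, coeff_zero, h2] at h1
  rcases mul_eq_zero.1 h1 with h1 | h1
  · exact mem_support_iff.1 hm h1
  · exact Nat.cast_add_one_ne_zero _ h1

theorem eq_of_vars_subset_of_isHomogeneous_two {w : Fock} (hw : w.IsHomogeneous 2)
    (hv : ∀ i ∈ w.vars, i = 1) : w = coeff (Finsupp.single 1 2) w • X 1 ^ 2 := by
  ext m
  rw [X_pow_eq_monomial, coeff_smul, coeff_monomial]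
  split_ifs with h
  · simp [h]
  · rw [smul_zero]
    by_contra hm
    have h2 := degree_eq_of_isHomogeneous hw hm
    have h3 : m = Finsupp.single 1 (m 1) := by
      rw [← Finsupp.support_subset_singleton]
      intro i hi
      exact Finset.mem_singleton.2
        (hv i ((mem_vars_iff_mem_support i).2 ⟨m, mem_support_iff.2 hm, hi⟩))
    rw [h3, Finsupp.degree_single] at h2
    exact h (by rw [h3, h2])

/-- The quadratic part of a Virasoro vector. -/
theorem IsVirasoroVector.sub_mem_degLE_one {v : Fock} (hv : IsVirasoroVector Y vacuum v) :
    v - (1 / 2 : ℂ) • X 1 ^ 2 ∈ degLE 1 := by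
  obtain ⟨h0, c, h4, h3, -, h1, -⟩ := hv
  set k := v.totalDegree with hk
  have hvk : v ∈ degLE k := totalDegree_mem_degLE v
  set w := homogeneousComponent k v with hw
  have hw0 : w ≠ 0 := homogeneousComponent_totalDegree_ne_zero h0
  have hwh : w.IsHomogeneous k := homogeneousComponent_isHomogeneous k v
  have hwk : w ∈ degLE k := homogeneousComponent_mem_degLE k v
  have hr : v - w ∈ degLE (k - 1) := sub_homogeneousComponent_mem_degLE hvk
  have hvnot : v ∉ degLE (k - 1) := fun h => hw0 (homogeneousComponent_eq_zero_of_mem_degLE h)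
  -- 2v = v_(1)v has degree k but lies in degree at most 2k-2.
  have hk2 : 2 ≤ k := by
    by_contra hlt
    have h5 := Y_mode_mem hvk hvk 1
    rw [Nat.cast_one, h1] at h5
    have h6 := Submodule.smul_mem _ (2⁻¹ : ℂ) h5
    rw [smul_smul, inv_mul_cancel₀ two_ne_zero, one_smul] at h6
    exact hvnot (mem_degLE_of_le h6 (by lia))
  have hvars : w.vars.Nonempty := by
    obtain ⟨m, hm⟩ := exists_coeff_ne_zero hw0
    have h2 := degree_eq_of_isHomogeneous hwh hm
    have hm0 : m ≠ 0 := by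
      rintro rfl
      rw [map_zero] at h2
      lia
    obtain ⟨i, hi⟩ := Finsupp.support_nonempty_iff.2 hm0
    exact ⟨i, (mem_vars_iff_mem_support i).2 ⟨m, mem_support_iff.2 hm, hi⟩⟩
  set N := w.vars.max' hvars
  have hNw : ∀ i ∈ w.vars, i ≤ N := fun i hi => Finset.le_max' _ _ hi
  have hpd : pderiv N w ≠ 0 := pderiv_ne_zero_of_mem_vars (Finset.max'_mem _ hvars)
  -- N bounds only the variables of w. Lower terms of v may involve larger indices, but any product
  -- with them already has degree at most 2k-3.
  have hpole : ((Y v)[[((2 * (N : ℕ) - 1 : ℕ) : ℤ)]]) v -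
      poleCoeff N • (pderiv N w * pderiv N w) ∈ degLE (k + k - 3) := by
    have h5 := Y_pole N hwk hNw hwk hNw
    have h6 := Y_mode_mem hr hvk (2 * (N : ℕ) - 1)
    have h7 := Y_mode_mem hwk hr (2 * (N : ℕ) - 1)
    have h8 := Submodule.add_mem _ (Submodule.add_mem _
      (mem_degLE_of_le h6 (by lia : _ ≤ (k + k - 3 : ℤ)))
      (mem_degLE_of_le h7 (by lia : _ ≤ (k + k - 3 : ℤ)))) h5
    convert h8 using 1
    simp only [map_sub, Pi.sub_apply, LinearMap.sub_apply]
    abel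
  -- In a domain the square of ∂_N w ≠ 0 is nonzero, and it is homogeneous of degree 2k-2.
  have hsq : poleCoeff N • (pderiv N w * pderiv N w) ∉ degLE (k + k - 3) := by
    have h5 : (pderiv N w * pderiv N w).IsHomogeneous (k - 1 + (k - 1)) :=
      (hwh.pderiv).mul hwh.pderiv
    have h6 := notMem_degLE_of_isHomogeneous h5 (mul_ne_zero hpd hpd)
      (by lia : (k + k - 3 : ℤ) < ((k - 1 + (k - 1) : ℕ) : ℤ))
    intro h
    rw [← Int.cast_smul_eq_zsmul ℂ] at h
    have h7 := Submodule.smul_mem _ ((poleCoeff N : ℂ)⁻¹) h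
    rw [smul_smul, inv_mul_cancel₀ (by exact_mod_cast poleCoeff_ne_zero N), one_smul] at h7
    exact h6 h7
  have hnot : ((Y v)[[((2 * (N : ℕ) - 1 : ℕ) : ℤ)]]) v ∉ degLE (k + k - 3) := fun h =>
    hsq (by simpa using Submodule.sub_mem _ h hpole)
  have hN0 := N.pos
  -- If N = 2 the product is v_(3)v, a constant, and 0 ≤ 2k-3; if N ≥ 3 it is a mode of index at
  -- least 5, which vanishes.
  have hN : N = 1 := by
    rcases lt_trichotomy (N : ℕ) 2 with h | h | h
    · exact PNat.coe_injective (by rw [PNat.one_coe]; lia)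
    · exfalso
      have h5 : ((2 * (N : ℕ) - 1 : ℕ) : ℤ) = 3 := by lia
      rw [h5, h3] at hnot
      refine hnot (Submodule.smul_mem _ _ fun m hm => ?_)
      rw [vacuum, coeff_one] at hm
      have : m = 0 := by
        by_contra h'
        exact hm (if_neg (Ne.symm h'))
      rw [this, map_zero]
      lia
    · exact absurd (by rw [h4 _ (by lia)]; exact Submodule.zero_mem _) hnot
  rw [hN] at hpole hnot hNw
  have h5 : ((2 * ((1 : ℕ+) : ℕ) - 1 : ℕ) : ℤ) = 1 := rfl
  rw [h5, h1] at hpole hnot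
  -- Now 2v = v_(1)v, of degree k, must not lie in degree 2k-3, so k < 3.
  have hkeq : k = 2 := by
    by_contra hne
    exact hnot (Submodule.smul_mem _ _ (mem_degLE_of_le hvk (by lia)))
  rw [hkeq] at hwh hpole hr
  have hwX := eq_of_vars_subset_of_isHomogeneous_two hwh
    fun i hi => le_antisymm (hNw i hi) one_le
  set a := coeff (Finsupp.single 1 2) w
  have ha0 : a ≠ 0 := by
    intro h
    rw [h, zero_smul] at hwX
    exact hw0 hwX
  have h6 : (2 : ℂ) • w - poleCoeff 1 • (pderiv 1 w * pderiv 1 w) ∈ degLE 1 := by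
    have h7 := Submodule.sub_mem _ hpole
      (Submodule.smul_mem _ (2 : ℂ) (mem_degLE_of_le hr (by norm_num : _ ≤ ((2 : ℕ) + (2 : ℕ) - 3 : ℤ))))
    have h8 : (((2 : ℕ) : ℤ) + (2 : ℕ) - 3) = 1 := rfl
    rw [h8] at h7
    convert h7 using 1
    rw [smul_sub]
    abel
  -- With w = a x_1², comparing quadratic terms gives 2a = (2a)².
  have h7 : (2 : ℂ) • w - poleCoeff 1 • (pderiv 1 w * pderiv 1 w) =
      monomial (Finsupp.single 1 2) (2 * a - 4 * a ^ 2) := by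
    have h8 : monomial (Finsupp.single (1 : ℕ+) 2) (2 * a - 4 * a ^ 2) =
        (2 * a - 4 * a ^ 2) • (X 1 ^ 2 : Fock) := by
      rw [X_pow_eq_monomial, smul_monomial, smul_eq_mul, mul_one]
    rw [h8, hwX]
    simp [smul_eq_C_mul]
    have h9 : (C 2 : Fock) = 2 := map_ofNat C 2
    have h10 : (C 4 : Fock) = 4 := map_ofNat C 4
    rw [h9, h10]
    ring
  rw [h7] at h6
  have ha : a = 1 / 2 := by
    by_contra hne
    have h8 := h6 (Finsupp.single 1 2) (by
      rw [coeff_monomial, if_pos rfl]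
      have : 2 * a - 4 * a ^ 2 = -4 * a * (a - 1 / 2) := by ring
      rw [this]
      exact mul_ne_zero (mul_ne_zero (by norm_num) ha0) (sub_ne_zero.2 hne))
    rw [Finsupp.degree_single] at h8
    norm_num at h8
  rw [← ha, ← hwX]
  exact mem_degLE_of_le hr (by norm_num)

/-! ### The part of degree at most one -/

theorem eq_zero_or_eq_single_of_degree_le_one {m : ℕ+ →₀ ℕ} (h : m.degree ≤ 1) :
    m = 0 ∨ ∃ i, m = Finsupp.single i 1 := by
  rcases Nat.le_one_iff_eq_zero_or_eq_one.1 h with h | h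
  · exact Or.inl (Finsupp.degree_eq_zero_iff m |>.1 h)
  · rw [← length_sort, Multiset.length_sort, Multiset.card_eq_one] at h
    obtain ⟨i, hi⟩ := h
    exact Or.inr ⟨i, Multiset.toFinsupp.symm.injective (by simp [hi])⟩

/-- Among the non-negative modes of ∂^{(i-1)}α, those below i vanish, so of the linear states only
x_1 reaches mode 1; the identity field has only mode -1. -/
theorem Y_mode_one_eq_zero {r : Fock} (hr : r ∈ degLE 1) (h1 : coeff (Finsupp.single 1 1) r = 0) :
    (Y r)[[(1 : ℤ)]] = 0 := by
  refine LinearMap.ext fun u => ?_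
  rw [Y_mode, LinearMap.zero_apply]
  refine Finset.sum_eq_zero fun m hm => ?_
  have hd := hr m (mem_support_iff.1 hm)
  rcases eq_zero_or_eq_single_of_degree_le_one (by exact_mod_cast hd : m.degree ≤ 1) with
    rfl | ⟨i, rfl⟩
  · simp [monomialField, BosonField.one_mode]
  · have hi : i ≠ 1 := by
      rintro rfl
      exact mem_support_iff.1 hm h1
    simp only [Finsupp.toMultiset_single, one_smul, Multiset.sort_singleton, monomialField_cons,
      monomialField_nil, BosonField.normalOrder_one]
    have h2 : (((BosonField.hasse ((i : ℕ) - 1) alpha)[[((1 : ℕ) : ℤ)]]) u) = 0 := by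
      rcases hasse_alpha_nonneg ((i : ℕ) - 1) 1 u with h | ⟨j, hj, -⟩
      · exact h
      · have := j.pos
        have := i.pos
        exact absurd (PNat.coe_injective (by rw [PNat.one_coe]; lia)) hi
    rw [Nat.cast_one] at h2
    rw [h2, smul_zero]

/-- Every Virasoro vector belongs to the two-parameter family. -/
theorem IsVirasoroVector.eq_conformalVector {v : Fock} (hv : IsVirasoroVector Y vacuum v) :
    ∃ lam mu : ℂ, v = conformalVector lam mu := by
  have hq := IsVirasoroVector.sub_mem_degLE_one hv
  set r := v - (1 / 2 : ℂ) • X 1 ^ 2 with hr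
  set lam := coeff (Finsupp.single 2 1) r with hlam
  set mu := coeff (Finsupp.single 1 1) r with hmu
  refine ⟨lam, mu, ?_⟩
  set s := v - conformalVector lam mu with hs
  have hsr : s = r - (C (mu ^ 2 / 2) + mu • X 1 + lam • X 2) := by
    rw [hs, hr, conformalVector]
    abel
  have hC (c : ℂ) : (C c : Fock) ∈ degLE 1 := fun m hm => by
    rw [coeff_C] at hm
    have : m = 0 := by
      by_contra h'
      exact hm (if_neg (Ne.symm h'))
    rw [this, map_zero]
    norm_num
  have hX (i : ℕ+) : (X i : Fock) ∈ degLE 1 := by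
    simpa using X_mul_mem_degLE (d := 0) (p := 1) (fun m hm => by
      rw [coeff_one] at hm
      have : m = 0 := by
        by_contra h'
        exact hm (if_neg (Ne.symm h'))
      rw [this, map_zero, Nat.cast_zero]) i
  have hs1 : s ∈ degLE 1 := by
    rw [hsr]
    exact Submodule.sub_mem _ hq (Submodule.add_mem _ (Submodule.add_mem _ (hC _)
      (Submodule.smul_mem _ _ (hX 1))) (Submodule.smul_mem _ _ (hX 2)))
  have hc (i : ℕ+) : coeff (Finsupp.single i 1) s = coeff (Finsupp.single i 1) r -
      ((if i = 1 then mu else 0) + if i = 2 then lam else 0) := by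
    rw [hsr]
    simp [coeff_X, coeff_C, Finsupp.single_left_inj, eq_comm]
  have hc1 : coeff (Finsupp.single 1 1) s = 0 := by
    rw [hc, if_pos rfl, if_neg (by decide), ← hmu, add_zero, sub_self]
  have hc2 : coeff (Finsupp.single 2 1) s = 0 := by
    rw [hc, if_pos rfl, if_neg (by decide), ← hlam, zero_add, sub_self]
  -- The unknown s does not alter L_0, so the quadratic condition v_(1)v = 2v becomes linear in s.
  have hop : (Y v)[[(1 : ℤ)]] = (Y (conformalVector lam mu))[[(1 : ℤ)]] := by
    have h1 := Y_mode_one_eq_zero hs1 hc1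
    rw [hs, map_sub, map_sub, Pi.sub_apply] at h1
    exact sub_eq_zero.1 h1
  obtain ⟨-, -, -, -, -, hv1, -⟩ := hv
  obtain ⟨-, -, -, -, -, hc1', -⟩ := isVirasoroVector_conformalVector lam mu
  have hDs : ((Y (conformalVector lam mu))[[(1 : ℤ)]]) s = (2 : ℂ) • s := by
    rw [hop] at hv1
    rw [hs, map_sub, hv1, hc1', smul_sub]
  rw [conformalVector_mode_one] at hDs
  set g : ℕ+ → Fock := fun i => (i : ℕ) • X i + if i = 1 then C mu else 0
  set W : (ℕ+ →₀ ℕ) → ℂ := fun m => m.sum fun i e => (e : ℂ) * (i : ℕ) with hW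
  -- Since x_1 is absent from s, the shift by μ plays no role and L_0 is diagonal on the monomials
  -- of s.
  have hmon : ∀ m ∈ s.support, mkDerivation ℂ g (monomial m (coeff m s)) =
      W m • monomial m (coeff m s) := by
    intro m hm
    have hd := hs1 m (mem_support_iff.1 hm)
    rcases eq_zero_or_eq_single_of_degree_le_one (by exact_mod_cast hd : m.degree ≤ 1) with
      rfl | ⟨i, rfl⟩
    · simp [hW]
    · have hi : i ≠ 1 := by
        rintro rfl
        exact mem_support_iff.1 hm hc1
      simp [hW, mkDerivation_monomial, g, hi, X, smul_monomial, mul_comm]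
  have hcoeff (m : ℕ+ →₀ ℕ) : coeff m (mkDerivation ℂ g s) = W m * coeff m s := by
    conv_lhs => rw [s.as_sum, map_sum, Finset.sum_congr rfl hmon, coeff_sum]
    simp only [coeff_smul, coeff_monomial, smul_eq_mul, mul_ite, mul_zero, Finset.sum_ite_eq',
      mem_support_iff, ite_not]
    split_ifs with h
    · rw [h, mul_zero]
    · rfl
  refine sub_eq_zero.1 (MvPolynomial.ext _ _ fun m => ?_)
  rw [← hs, coeff_zero]
  by_contra hm
  have h2 := hcoeff m
  rw [hDs, coeff_smul, smul_eq_mul] at h2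
  have h3 := mul_right_cancel₀ hm h2
  -- A surviving monomial has weight 2. A constant has weight 0, which is how μ²/2 is forced; x_i
  -- has weight i, and the x_2 coefficient was removed by the choice of λ.
  rcases eq_zero_or_eq_single_of_degree_le_one (by exact_mod_cast hs1 m hm : m.degree ≤ 1) with
    rfl | ⟨i, rfl⟩
  · simp [hW] at h3
  · rw [hW] at h3
    simp only [Nat.cast_zero, zero_mul, Finsupp.sum_single_index, Nat.cast_one, one_mul] at h3
    have h4 : i = 2 := PNat.coe_injective (by exact_mod_cast h3.symm)
    exact hm (h4 ▸ hc2)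

end FreeBoson

end

theorem corollary3p4 :
    (∀ v : Fock, IsVirasoroVector FreeBoson.Y FreeBoson.vacuum v →
      IsConformalVector FreeBoson.Y FreeBoson.vacuum v) ∧
    ∀ v : Fock, IsConformalVector FreeBoson.Y FreeBoson.vacuum v ↔
      ∃ lam mu : ℂ, v = MvPolynomial.C (mu ^ 2 / 2) + mu • MvPolynomial.X 1 +
        (1 / 2 : ℂ) • MvPolynomial.X 1 ^ 2 + lam • MvPolynomial.X 2 := by
  refine ⟨fun v hv => ?_, fun v => ⟨fun hv => ?_, ?_⟩⟩
  · obtain ⟨lam, mu, rfl⟩ := FreeBoson.IsVirasoroVector.eq_conformalVector hv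
    exact FreeBoson.isConformalVector_conformalVector lam mu
  · exact FreeBoson.IsVirasoroVector.eq_conformalVector hv.1
  · rintro ⟨lam, mu, rfl⟩
    exact FreeBoson.isConformalVector_conformalVector lam mu
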